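/- Let $\mathbb C_\omega$ be the strict partial order on $\mathbb Q\times\omega$ given by $\langle q_1,i_1\rangle<\langle q_2,i_2\rangle \Leftrightarrow q_1<_{\mathbb Q}q_2$, and let $\mathbb P(\mathbb C_\omega)$ be the set of all $A\subset\mathbb Q\times\omega$ such that $A$ with the restriction of this order is isomorphic to $\mathbb C_\omega$. A linear order $L$ is called *complete* if it has a least element $0_L$ and a greatest element and has no gaps (for every partition of $L$ into nonempty sets $A,B$ with $a<b$ for all $a\in A$, $b\in B$, either $A$ has a maximum or $B$ has a minimum); it is *$\mathbb R$-embeddable* if it is isomorphic to a subset of $\mathbb R$ with the induced order; and $0_L$ is *non-isolated* if $L\neq\{0_L\}$ and $0_L$ has no immediate successor in $L$. Then for each $\mathbb R$-embeddable complete linear order $L$ with $0_L$ non-isolated there is a maximal chain in the poset $\langle\mathbb P(\mathbb C_\omega)\cup\{\emptyset\},\subset\rangle$ which, ordered by inclusion, is isomorphic to $L$. -/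

import Mathlib

/-- The set `ℙ(X)` of (domains of) copies of a relational structure `⟨X, r⟩` inside itself: all
`A ⊆ X` such that the substructure `⟨A, r ∩ A²⟩` is isomorphic to `⟨X, r⟩`. -/
def copies {X : Type*} (r : X → X → Prop) : Set (Set X) :=
  {A | Nonempty (Subrel r (· ∈ A) ≃r r)}

/-- The strict order of the partial order `ℂ_ω` on `ℚ × ω`: comparison of first coordinates. -/
def cOmegaLt (p q : ℚ × ℕ) : Prop :=
  p.1 < q.1

/-- A linear order is complete if it has a least and a greatest element and has no gaps: for every
cut `⟨A, B⟩`, the set `A` has a greatest element or the set `B` has a least element. -/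
def IsCompleteLinOrder (L : Type*) [LinearOrder L] : Prop :=
  (∃ a : L, IsBot a) ∧ (∃ b : L, IsTop b) ∧
    ∀ A B : Set L, A.Nonempty → B.Nonempty → A ∪ B = Set.univ → (∀ a ∈ A, ∀ b ∈ B, a < b) →
      (∃ m, IsGreatest A m) ∨ (∃ m, IsLeast B m)

/-- The linear order `L` has a least element `0_L`, and `0_L` is non-isolated (it is not the only
element, and every interval `[0_L, x)` with `x > 0_L` contains an element other than `0_L`). -/
def MinNonIsolated (L : Type*) [LinearOrder L] : Prop :=
  ∃ z : L, IsBot z ∧ (∃ x, z < x) ∧ ∀ x, z < x → ∃ y, z < y ∧ y < x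

/-! Build a copy of `ℂ_ω` whose points `p` carry a rank `t p` in `L` (when `p` enters the chain) and
a row `ρ p` (its place in the order); the chain consists of the sets `{p | t p < y}`. A point `d` of
a countable set `D`, dense in the jump-free parts of `L`, contributes an infinite row at height `d`.
A jump `u ⋖ v` contributes a single point, placed in a row below `u`. Nothing fits in between: at a
jump only one point is added, and at `d` any new point would be maximal, while copies of `ℂ_ω` have
no maximal points. Since `0_L` is non-isolated, there are rows or jumps arbitrarily close to it,
which makes even the small segments copies. -/

theorem IsCompleteLinOrder.exists_isLUB {L : Type*} [LinearOrder L] (h : IsCompleteLinOrder L)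
    (S : Set L) : ∃ m, IsLUB S m := by
  obtain ⟨⟨z, hz⟩, ⟨w, hw⟩, hcut⟩ := h
  by_cases hmax : ∃ m, IsGreatest S m
  · exact hmax.imp fun m hm => hm.isLUB
  rcases S.eq_empty_or_nonempty with rfl | ⟨s₀, hs₀⟩
  · exact ⟨z, by simpa using hz⟩
  have hB : ∀ s ∈ S, ∃ s' ∈ S, s < s' := by
    intro s hs
    by_contra! hcon
    exact hmax ⟨s, hs, hcon⟩
  rcases hcut {x | ∃ s ∈ S, x ≤ s} {x | ∀ s ∈ S, s < x} ⟨s₀, s₀, hs₀, le_rfl⟩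
      ⟨w, fun s hs => by
        obtain ⟨s', -, h'⟩ := hB s hs
        exact h'.trans_le (hw s')⟩
      (by
        ext x
        refine iff_of_true (or_iff_not_imp_left.2 fun h s hs => ?_) trivial
        exact not_le.1 fun hle => h ⟨s, hs, hle⟩)
      (fun a ⟨s, hs, ha⟩ b hb => ha.trans_lt (hb s hs)) with ⟨m, ⟨s, hs, hm⟩, hm'⟩ | ⟨m, hm, hm'⟩
  · obtain ⟨s', hs', hlt⟩ := hB s hs
    exact absurd (hm' ⟨s', hs', le_rfl⟩) (not_le.2 (hm.trans_lt hlt))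
  · refine ⟨m, fun s hs => (hm s hs).le, fun b hb => hm' fun s hs => ?_⟩
    obtain ⟨s', hs', hlt⟩ := hB s hs
    exact hlt.trans_le (hb hs')

/-! ### Maximal chains from rank functions -/

/-- A function `t` on `X` whose strict initial segments `{p | t p < y}` are copies of `⟨X, r⟩`
for all non-minimal `y` and admit no further copies in between generates a maximal chain. -/
theorem exists_isMaxChain_of_rank {X L : Type*} [LinearOrder L] {r : X → X → Prop}
    (hlub : ∀ S : Set L, ∃ m, IsLUB S m) (t : X → L) {z : L} (hz : IsBot z)
    (hcopy : ∀ y, z < y → {p | t p < y} ∈ copies r)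
    (hstrict : ∀ u v, u < v → ∃ p, u ≤ t p ∧ t p < v)
    (hgap : ∀ u, ∀ C ∈ copies r, {p | t p < u} ⊆ C → C ⊆ {p | t p ≤ u} →
      ∃ v, C = {p | t p < v}) :
    ∃ 𝓛 : Set (copies r ∪ {∅} : Set (Set X)), IsMaxChain (· ≤ ·) 𝓛 ∧ Nonempty (L ≃o 𝓛) := by
  have hempty : {p | t p < z} = ∅ := by
    ext p
    simpa using hz (t p)
  let F : L → (copies r ∪ {∅} : Set (Set X)) := fun y => ⟨{p | t p < y}, by
    rcases (hz y).lt_or_eq with h | rfl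
    · exact Or.inl (hcopy y h)
    · exact Or.inr hempty⟩
  have hF : StrictMono F := by
    intro u v huv
    obtain ⟨p, hp, hp'⟩ := hstrict u v huv
    refine lt_of_le_not_ge (fun q (hq : t q < u) => hq.trans huv) fun hle => ?_
    exact absurd (hle (show p ∈ {p | t p < v} from hp')) (not_lt.2 hp)
  refine ⟨Set.range F, ⟨hF.monotone.isChain_range, fun 𝒯 h𝒯 hsub => ?_⟩,
    ⟨hF.orderIso⟩⟩
  refine hsub.antisymm fun C hC => ?_
  have hcmp : ∀ y, {p | t p < y} ⊆ C.1 ∨ C.1 ⊆ {p | t p < y} := fun y =>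
    h𝒯.total (hsub ⟨y, rfl⟩) hC
  -- Comparability with every segment pins `C` between the strict and weak segments at this
  -- supremum.
  obtain ⟨u, hu⟩ := hlub {x | {p | t p < x} ⊆ C.1}
  have hlow : {p | t p < u} ⊆ C.1 := by
    intro p hp
    obtain ⟨x, hx, hpx⟩ := (lt_isLUB_iff hu).1 hp
    exact hx hpx
  have hupp : C.1 ⊆ {p | t p ≤ u} := by
    intro p hp
    by_contra hlt
    rcases hcmp (t p) with h | h
    · exact hlt (hu.1 h)
    · exact lt_irrefl _ (h hp)
  rcases C.2 with h | h
  · obtain ⟨v, hv⟩ := hgap u _ h hlow hupp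
    exact ⟨v, Subtype.ext hv.symm⟩
  · exact ⟨z, Subtype.ext (hempty.trans h.symm)⟩

/-! ### Recognising copies of `ℂ_ω` -/

theorem preimage_mem_copies_iff {X Y : Type*} {r : X → X → Prop} {s : Y → Y → Prop} (e : r ≃r s)
    (C : Set Y) : e ⁻¹' C ∈ copies r ↔ C ∈ copies s := by
  let g : Subrel r (· ∈ e ⁻¹' C) ≃r Subrel s (· ∈ C) :=
    ⟨e.toEquiv.subtypeEquiv fun _ => Iff.rfl, e.map_rel_iff⟩
  exact ⟨fun ⟨f⟩ => ⟨(g.symm.trans f).trans e⟩, fun ⟨f⟩ => ⟨(g.trans f).trans e.symm⟩⟩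

/-- A countable family of infinite antichains along a countable dense linear order `S` without
endpoints is isomorphic to `ℂ_ω`. -/
theorem nonempty_subrel_relIso_cOmegaLt {P R : Type*} [Countable P] [LinearOrder R]
    (ρ : P → R) (A : Set P) (S : Set R) (hS : S.Nonempty) (hmax : ∀ s ∈ S, ∃ s' ∈ S, s < s')
    (hmin : ∀ s ∈ S, ∃ s' ∈ S, s' < s)
    (hdense : ∀ s ∈ S, ∀ s' ∈ S, s < s' → ∃ s'' ∈ S, s < s'' ∧ s'' < s')
    (hmem : ∀ p ∈ A, ρ p ∈ S) (hinf : ∀ s ∈ S, {p | p ∈ A ∧ ρ p = s}.Infinite) :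
    Nonempty (Subrel (fun p p' => ρ p < ρ p') (· ∈ A) ≃r cOmegaLt) := by
  have : Nonempty S := hS.to_subtype
  have : NoMaxOrder S := ⟨fun ⟨s, hs⟩ =>
    let ⟨s', hs', h⟩ := hmax s hs
    ⟨⟨s', hs'⟩, h⟩⟩
  have : NoMinOrder S := ⟨fun ⟨s, hs⟩ =>
    let ⟨s', hs', h⟩ := hmin s hs
    ⟨⟨s', hs'⟩, h⟩⟩
  have : DenselyOrdered S := ⟨fun ⟨s, hs⟩ ⟨s', hs'⟩ hlt =>
    let ⟨s'', hs'', h⟩ := hdense s hs s' hs' hlt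
    ⟨⟨s'', hs''⟩, h⟩⟩
  let π : {p // p ∈ A} → S := fun p => ⟨ρ p, hmem p p.2⟩
  have hfib : ∀ s : S, Infinite {p // π p = s} := by
    rintro ⟨s, hs⟩
    have := (hinf s hs).to_subtype
    exact Infinite.of_injective
      (fun p : {p | p ∈ A ∧ ρ p = s} => (⟨⟨p, p.2.1⟩, Subtype.ext p.2.2⟩ : {p // π p = ⟨s, hs⟩}))
      fun p q h => Subtype.ext (congrArg (fun x => (x : {p // π p = ⟨s, hs⟩}).1.1) h)
  have hsurj : Function.Surjective π := fun s =>
    let ⟨p⟩ := (hfib s).nonempty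
    ⟨p.1, p.2⟩
  have : Countable S := hsurj.countable
  obtain ⟨f⟩ := Order.iso_of_countable_dense S ℚ
  have g : ∀ s : S, Nonempty ({p // π p = s} ≃ ℕ) := fun s => nonempty_equiv_of_countable
  let e : {p // p ∈ A} ≃ ℚ × ℕ := (Equiv.sigmaFiberEquiv π).symm.trans
    ((Equiv.sigmaCongrRight fun s => (g s).some).trans
      ((Equiv.sigmaEquivProd _ _).trans (f.toEquiv.prodCongr (Equiv.refl ℕ))))
  have he : ∀ p, (e p).1 = f (π p) := fun p => rfl
  refine ⟨⟨e, ?_⟩⟩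
  intro p p'
  simp only [cOmegaLt, he, f.lt_iff_lt]
  rfl

theorem exists_gt_of_mem_copies_cOmegaLt {X : Type*} {r : X → X → Prop} (e : r ≃r cOmegaLt)
    {C : Set X} (hC : C ∈ copies r) {p : X} (hp : p ∈ C) : ∃ p' ∈ C, r p p' := by
  obtain ⟨f⟩ := hC
  let g := f.trans e
  obtain ⟨q, hq⟩ := exists_gt (g ⟨p, hp⟩).1
  refine ⟨g.symm (q, 0), (g.symm (q, 0)).2, ?_⟩
  have : Subrel r (· ∈ C) ⟨p, hp⟩ (g.symm (q, 0)) := by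
    rw [← g.map_rel_iff]
    simpa [cOmegaLt] using hq
  exact this

/-! ### Countable data in `L` and in the set of jumps -/

theorem countable_setOf_exists_covBy {L : Type*} [LinearOrder L] (e : L ↪o ℝ) :
    {u : L | ∃ v, u ⋖ v}.Countable := by
  have h : ∀ u : {u : L | ∃ v, u ⋖ v}, ∃ q : ℚ, e u < q ∧ ∀ w, u < w → q < e w := by
    rintro ⟨u, v, huv⟩
    obtain ⟨q, h1, h2⟩ := exists_rat_btwn (e.lt_iff_lt.2 huv.lt)
    exact ⟨q, h1, fun w hw => h2.trans_le (e.le_iff_le.2 (huv.ge_of_gt hw))⟩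
  choose q hq using h
  have hmono : StrictMono q := fun u u' huu' => by
    exact_mod_cast ((hq u).2 u' huu').trans (hq u').1
  exact Set.countable_coe_iff.1 hmono.injective.countable

/-- One point of `L` is chosen in each rational interval that meets the image of `e`. -/
theorem exists_countable_btwn {L : Type*} [LinearOrder L] (e : L ↪o ℝ) :
    ∃ E : Set L, E.Countable ∧ ∀ x w y, x < w → w < y → ∃ d ∈ E, x < d ∧ d < y := by
  let I := {ab : ℚ × ℚ // ∃ x, (ab.1 : ℝ) < e x ∧ e x < ab.2}
  choose g hg using fun i : I => i.2
  refine ⟨Set.range g, Set.countable_range g, fun x w y hxw hwy => ?_⟩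
  obtain ⟨a, h1, h2⟩ := exists_rat_btwn (e.lt_iff_lt.2 hxw)
  obtain ⟨b, h3, h4⟩ := exists_rat_btwn (e.lt_iff_lt.2 hwy)
  let i : I := ⟨(a, b), w, h2, h3⟩
  exact ⟨g i, ⟨i, rfl⟩, e.lt_iff_lt.1 (h1.trans (hg i).1), e.lt_iff_lt.1 ((hg i).2.trans h4)⟩

/-- Colour a coinitial sequence by the first coordinates of an enumeration of `ℚ × ℕ`, so that every
colour recurs infinitely often. The colour `0` off the sequence is harmless. -/
theorem exists_forall_fiber_coinitial (J : Type*) [LinearOrder J] [Countable J] [Nonempty J]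
    [NoMinOrder J] : ∃ c : J → ℚ, ∀ q y, ∃ j < y, c j = q := by
  obtain ⟨s, -, hs⟩ := Filter.exists_seq_monotone_tendsto_atTop_atTop Jᵒᵈ
  obtain ⟨φ, hmono, hφ⟩ := Filter.strictMono_subseq_of_tendsto_atTop hs
  have hlim : Filter.Tendsto (s ∘ φ) Filter.atTop Filter.atTop :=
    hs.comp hmono.tendsto_atTop
  obtain ⟨g⟩ : Nonempty (ℕ ≃ ℚ × ℕ) := nonempty_equiv_of_countable
  have hfreq : ∀ q : ℚ, ∃ᶠ n in Filter.atTop, (g n).1 = q := by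
    intro q
    rw [Nat.frequently_atTop_iff_infinite]
    refine Set.infinite_of_injective_forall_mem (f := fun i : ℕ => g.symm (q, i))
      (fun i j h => ?_) fun i => ?_
    · simpa using h
    · simp
  refine ⟨fun j => Function.extend (s ∘ φ) (fun n => (g n).1) 0 (OrderDual.toDual j),
    fun q y => ?_⟩
  obtain ⟨n, hn, hlt⟩ :=
    ((hfreq q).and_eventually
      (hlim.eventually (Filter.eventually_gt_atTop (OrderDual.toDual y)))).exists
  refine ⟨OrderDual.ofDual ((s ∘ φ) n), hlt, ?_⟩
  exact (hφ.injective.extend_apply _ _ n).trans hn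

/-- The chain generated by points of rank in `D ∪ J`: full rows indexed by `D`, ordered as in `L`,
together with one point for every jump `u ∈ J`, lying in the row `c u`. -/
theorem exists_isMaxChain_of_rows {L : Type*} [LinearOrder L]
    (hlub : ∀ S : Set L, ∃ m, IsLUB S m) {z w : L} (hz : IsBot z) (hw : IsTop w) (hzw : z < w)
    {J D : Set L} (hJ : ∀ u ∈ J, ∃ v, u ⋖ v) (hD : ∀ d ∈ D, ∀ v, ¬ d ⋖ v)
    (hDw : ∀ d ∈ D, d < w)
    (hstrict : ∀ u v, u < v → ∃ a ∈ J ∪ D, u ≤ a ∧ a < v)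
    (c : J → ℚ ⊕ₗ L) (hc : ∀ j, c j < Sum.inrₗ j.1)
    (hiso : ∀ y, z < y → Nonempty (Subrel
      (fun p p' : J ⊕ D × ℕ => (Sum.elim c (fun x => Sum.inrₗ x.1.1) p : ℚ ⊕ₗ L) <
        Sum.elim c (fun x => Sum.inrₗ x.1.1) p')
      (· ∈ {p | Sum.elim (fun j => j.1) (fun x => x.1.1) p < y}) ≃r cOmegaLt)) :
    ∃ 𝓛 : Set (copies cOmegaLt ∪ {∅} : Set (Set (ℚ × ℕ))),
      IsMaxChain (· ≤ ·) 𝓛 ∧ Nonempty (L ≃o 𝓛) := by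
  set ρ : J ⊕ D × ℕ → ℚ ⊕ₗ L := Sum.elim c (fun x => Sum.inrₗ x.1.1) with hρ
  set t : J ⊕ D × ℕ → L := Sum.elim (fun j => j.1) (fun x => x.1.1) with ht
  have htop : ∀ p, t p < w := by
    rintro (⟨u, hu⟩ | ⟨⟨d, hd⟩, i⟩)
    · obtain ⟨v, hv⟩ := hJ u hu
      exact hv.lt.trans_le (hw v)
    · exact hDw d hd
  obtain ⟨f⟩ := hiso w hzw
  -- All ranks lie below `w`, so the segment at `w` is the whole structure.
  let e : (fun p p' => ρ p < ρ p') ≃r cOmegaLt :=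
    RelIso.trans ⟨(Equiv.subtypeUnivEquiv htop).symm, Iff.rfl⟩ f
  have hcopy : ∀ y, z < y → {p | t p < y} ∈ copies fun p p' => ρ p < ρ p' := fun y hy =>
    let ⟨g⟩ := hiso y hy
    ⟨g.trans e.symm⟩
  have hρle : ∀ p, ρ p ≤ Sum.inrₗ (t p) := by
    rintro (j | x)
    · exact (hc j).le
    · exact le_rfl
  have hgap : ∀ u, ∀ C ∈ copies (fun p p' => ρ p < ρ p'), {p | t p < u} ⊆ C →
      C ⊆ {p | t p ≤ u} → ∃ v, C = {p | t p < v} := by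
    intro u C hC hlow hupp
    by_cases hCu : ∃ p ∈ C, t p = u
    · obtain ⟨p, hp, rfl⟩ := hCu
      rcases p with j | x
      · obtain ⟨v, hv⟩ := hJ j j.2
        refine ⟨v, Set.Subset.antisymm (fun p hp => (hupp hp).trans_lt hv.lt) fun p hpv => ?_⟩
        rcases (hv.le_of_lt hpv : t p ≤ j).lt_or_eq with h | h
        · exact hlow h
        · rcases p with j' | x'
          · obtain rfl : j' = j := Subtype.ext h
            exact hp
          · exact absurd hv (h ▸ hD _ x'.1.2 v)
      -- Rows never exceed ranks, so a point in row `u` is maximal in `C`.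
      · obtain ⟨p', hp', hlt⟩ := exists_gt_of_mem_copies_cOmegaLt e hC hp
        have h1 : ρ p' ≤ Sum.inrₗ (x.1 : L) :=
          (hρle p').trans (Sum.Lex.inr_le_inr_iff.2 (hupp hp'))
        exact absurd hlt (not_lt.2 h1)
    · push Not at hCu
      exact ⟨u, Set.Subset.antisymm (fun p hp => (hupp hp).lt_of_ne (hCu p hp)) hlow⟩
  refine exists_isMaxChain_of_rank hlub (t ∘ e.symm) hz (fun y hy => ?_) (fun u v huv => ?_)
    fun u C hC hlow hupp => ?_
  · exact (preimage_mem_copies_iff e.symm _).2 (hcopy y hy)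
  · obtain ⟨a, ha, hua, hav⟩ := hstrict u v huv
    obtain ⟨p, rfl⟩ : ∃ p, t p = a := by
      rcases ha with ha | ha
      · exact ⟨.inl ⟨a, ha⟩, rfl⟩
      · exact ⟨.inr ⟨⟨a, ha⟩, 0⟩, rfl⟩
    exact ⟨e p, by simpa using hua, by simpa using hav⟩
  · obtain ⟨v, hv⟩ := hgap u (e ⁻¹' C) ((preimage_mem_copies_iff e C).2 hC)
      (fun p hp => hlow (by simpa using hp)) (fun p hp => by simpa using hupp hp)
    refine ⟨v, ?_⟩
    ext q
    simpa using Set.ext_iff.1 hv (e.symm q)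

theorem theorem8 {L : Type*} [LinearOrder L]
    (hR : Nonempty (L ↪o ℝ)) (hc : IsCompleteLinOrder L) (h0 : MinNonIsolated L) :
    ∃ 𝓛 : Set (copies cOmegaLt ∪ {∅} : Set (Set (ℚ × ℕ))),
      IsMaxChain (· ≤ ·) 𝓛 ∧ Nonempty (L ≃o 𝓛) := by
  obtain ⟨e⟩ := hR
  obtain ⟨z, hz, ⟨x₀, hx₀⟩, h0⟩ := h0
  obtain ⟨w, hw⟩ := hc.2.1
  obtain ⟨E, hE, hbtw⟩ := exists_countable_btwn e
  set J : Set L := {u | z < u ∧ ∃ v, u ⋖ v} with hJ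
  set D : Set L := {d | d ∈ E ∧ ∃ a b, a < d ∧ d < b ∧
    ∀ x y, a ≤ x → y ≤ b → x < y → ∃ m, x < m ∧ m < y} with hD
  have hJc : Countable J := ((countable_setOf_exists_covBy e).mono fun u hu => hu.2).to_subtype
  have hDc : Countable D := (hE.mono fun d hd => hd.1).to_subtype
  have hDbtw : ∀ u v, u < v → (∀ x y, u ≤ x → y ≤ v → x < y → ∃ m, x < m ∧ m < y) →
      ∃ d ∈ D, u < d ∧ d < v := by
    intro u v huv h
    obtain ⟨m, hm1, hm2⟩ := h u v le_rfl le_rfl huv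
    obtain ⟨d, hd, h1, h2⟩ := hbtw u m v hm1 hm2
    exact ⟨d, ⟨hd, u, v, h1, h2, h⟩, h1, h2⟩
  have hDgt : ∀ d ∈ D, ∀ y, d < y → ∃ d' ∈ D, d < d' ∧ d' < y := by
    rintro d ⟨-, a, b, had, hdb, h⟩ y hy
    obtain ⟨d', hd', h1, h2⟩ := hDbtw d (min y b) (lt_min hy hdb) fun x m hx hm =>
      h x m (had.le.trans hx) (hm.trans (min_le_right _ _))
    exact ⟨d', hd', h1, h2.trans_le (min_le_left _ _)⟩
  have hDlt : ∀ d ∈ D, ∃ d' ∈ D, d' < d := by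
    rintro d ⟨-, a, b, had, hdb, h⟩
    obtain ⟨d', hd', h1, h2⟩ := hDbtw a d had fun x m hx hm => h x m hx (hm.trans hdb.le)
    exact ⟨d', hd', h2⟩
  have hstrict : ∀ u v, u < v → ∃ a ∈ J ∪ D, u ≤ a ∧ a < v := by
    have key : ∀ u v, z < u → u < v → ∃ a ∈ J ∪ D, u ≤ a ∧ a < v := by
      intro u v hu huv
      by_cases h : ∀ x y, u ≤ x → y ≤ v → x < y → ∃ m, x < m ∧ m < y
      · obtain ⟨d, hd, h1, h2⟩ := hDbtw u v huv h
        exact ⟨d, Or.inr hd, h1.le, h2⟩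
      · push Not at h
        obtain ⟨x, y, hx, hy, hxy, h⟩ := h
        exact ⟨x, Or.inl ⟨hu.trans_le hx, y, hxy, fun m h1 h2 => absurd h2 (not_lt.2 (h m h1))⟩,
          hx, hxy.trans_le hy⟩
    intro u v huv
    -- Non-isolation moves the left end off `z`, as `J` excludes `z`.
    obtain ⟨y, hy, hyv⟩ := h0 v ((hz u).trans_lt huv)
    obtain ⟨a, ha, h1, h2⟩ := key (max u y) v (lt_max_of_lt_right hy) (max_lt huv hyv)
    exact ⟨a, ha, (le_max_left _ _).trans h1, h2⟩
  have hDw : ∀ d ∈ D, d < w := by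
    rintro d ⟨-, a, b, -, hdb, -⟩
    exact hdb.trans_le (hw b)
  have hDcov : ∀ d ∈ D, ∀ v, ¬ d ⋖ v := by
    intro d hd v hv
    obtain ⟨d', -, h1, h2⟩ := hDgt d hd v hv.lt
    exact hv.2 h1 h2
  have hrow : ∀ (c : J → ℚ ⊕ₗ L) (y : L), ∀ d ∈ D, d < y → {p : J ⊕ D × ℕ |
      p ∈ {p | Sum.elim (fun j => j.1) (fun x => x.1.1) p < y} ∧
        (Sum.elim c (fun x => Sum.inrₗ x.1.1) p : ℚ ⊕ₗ L) = Sum.inrₗ d}.Infinite := by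
    intro c y d hd hdy
    refine Set.infinite_of_injective_forall_mem
      (f := fun i : ℕ => (Sum.inr (⟨d, hd⟩, i) : J ⊕ D × ℕ)) (fun i j h => ?_) fun i => ?_
    · simpa using h
    · exact ⟨hdy, rfl⟩
  have hzw : z < w := hx₀.trans_le (hw x₀)
  -- If `D` accumulates at `z`, jump points join existing rows. Otherwise jumps accumulate there,
  -- and their points alone must fill new rows indexed by `ℚ`.
  by_cases hcase : ∀ y, z < y → ∃ d ∈ D, d < y
  · choose c hcD hc' using fun j : J => hcase j.1 j.2.1
    refine exists_isMaxChain_of_rows hc.exists_isLUB hz hw hzw (fun u hu => hu.2) hDcov hDw hstrict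
      (fun j => Sum.inrₗ (c j)) (fun j => Sum.Lex.inr_lt_inr_iff.2 (hc' j)) fun y hy => ?_
    refine nonempty_subrel_relIso_cOmegaLt _ _ (Sum.inrₗ '' {d | d ∈ D ∧ d < y}) ?_ ?_ ?_ ?_ ?_ ?_
    · obtain ⟨d, hd⟩ := hcase y hy
      exact ⟨_, d, hd, rfl⟩
    · rintro _ ⟨d, ⟨hd, hdy⟩, rfl⟩
      obtain ⟨d', hd', h1, h2⟩ := hDgt d hd y hdy
      exact ⟨_, ⟨d', ⟨hd', h2⟩, rfl⟩, Sum.Lex.inr_lt_inr_iff.2 h1⟩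
    · rintro _ ⟨d, ⟨hd, hdy⟩, rfl⟩
      obtain ⟨d', hd', h1⟩ := hDlt d hd
      exact ⟨_, ⟨d', ⟨hd', h1.trans hdy⟩, rfl⟩, Sum.Lex.inr_lt_inr_iff.2 h1⟩
    · rintro _ ⟨d, ⟨hd, hdy⟩, rfl⟩ _ ⟨d₂, ⟨hd₂, hd₂y⟩, rfl⟩ hlt
      obtain ⟨d', hd', h1, h2⟩ := hDgt d hd d₂ (Sum.Lex.inr_lt_inr_iff.1 hlt)
      exact ⟨_, ⟨d', ⟨hd', h2.trans hd₂y⟩, rfl⟩, Sum.Lex.inr_lt_inr_iff.2 h1,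
        Sum.Lex.inr_lt_inr_iff.2 h2⟩
    · rintro (j | x) hp
      · exact ⟨c j, ⟨hcD j, (hc' j).trans hp⟩, rfl⟩
      · exact ⟨x.1, ⟨x.1.2, hp⟩, rfl⟩
    · rintro _ ⟨d, ⟨hd, hdy⟩, rfl⟩
      exact hrow _ y d hd hdy
  · push Not at hcase
    obtain ⟨y₀, hy₀, hcase⟩ := hcase
    have hJlt : ∀ y, z < y → ∃ j : J, j.1 < y := by
      intro y hy
      obtain ⟨a, ha | ha, -, h2⟩ := hstrict z (min y y₀) (lt_min hy hy₀)
      · exact ⟨⟨a, ha⟩, h2.trans_le (min_le_left _ _)⟩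
      · exact absurd (h2.trans_le (min_le_right _ _)) (not_lt.2 (hcase a ha))
    have : Nonempty J := (hJlt y₀ hy₀).nonempty
    have : NoMinOrder J := ⟨fun j => hJlt j.1 j.2.1⟩
    obtain ⟨c, hcq⟩ := exists_forall_fiber_coinitial J
    refine exists_isMaxChain_of_rows hc.exists_isLUB hz hw hzw (fun u hu => hu.2) hDcov hDw hstrict
      (fun j => Sum.inlₗ (c j)) (fun j => Sum.Lex.inl_lt_inr _ _) fun y hy => ?_
    refine nonempty_subrel_relIso_cOmegaLt _ _
      (Set.range Sum.inlₗ ∪ Sum.inrₗ '' {d | d ∈ D ∧ d < y}) ⟨_, Or.inl ⟨0, rfl⟩⟩ ?_ ?_ ?_ ?_ ?_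
    · rintro _ (⟨q, rfl⟩ | ⟨d, ⟨hd, hdy⟩, rfl⟩)
      · exact ⟨_, Or.inl ⟨q + 1, rfl⟩, Sum.Lex.inl_lt_inl_iff.2 (lt_add_one q)⟩
      · obtain ⟨d', hd', h1, h2⟩ := hDgt d hd y hdy
        exact ⟨_, Or.inr ⟨d', ⟨hd', h2⟩, rfl⟩, Sum.Lex.inr_lt_inr_iff.2 h1⟩
    · rintro _ (⟨q, rfl⟩ | ⟨d, ⟨hd, hdy⟩, rfl⟩)
      · exact ⟨_, Or.inl ⟨q - 1, rfl⟩, Sum.Lex.inl_lt_inl_iff.2 (sub_one_lt q)⟩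
      · exact ⟨_, Or.inl ⟨0, rfl⟩, Sum.Lex.inl_lt_inr _ _⟩
    · rintro _ (⟨q, rfl⟩ | ⟨d, ⟨hd, hdy⟩, rfl⟩) _ (⟨q₂, rfl⟩ | ⟨d₂, ⟨hd₂, hd₂y⟩, rfl⟩) hlt
      · obtain ⟨r, h1, h2⟩ := exists_between (Sum.Lex.inl_lt_inl_iff.1 hlt)
        exact ⟨_, Or.inl ⟨r, rfl⟩, Sum.Lex.inl_lt_inl_iff.2 h1, Sum.Lex.inl_lt_inl_iff.2 h2⟩
      · exact ⟨_, Or.inl ⟨q + 1, rfl⟩, Sum.Lex.inl_lt_inl_iff.2 (lt_add_one q),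
          Sum.Lex.inl_lt_inr _ _⟩
      · exact absurd hlt Sum.Lex.not_inr_lt_inl
      · obtain ⟨d', hd', h1, h2⟩ := hDgt d hd d₂ (Sum.Lex.inr_lt_inr_iff.1 hlt)
        exact ⟨_, Or.inr ⟨d', ⟨hd', h2.trans hd₂y⟩, rfl⟩, Sum.Lex.inr_lt_inr_iff.2 h1,
          Sum.Lex.inr_lt_inr_iff.2 h2⟩
    · rintro (j | x) hp
      · exact Or.inl ⟨c j, rfl⟩
      · exact Or.inr ⟨x.1, ⟨x.1.2, hp⟩, rfl⟩
    · rintro _ (⟨q, rfl⟩ | ⟨d, ⟨hd, hdy⟩, rfl⟩)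
      · obtain ⟨j₀, hj₀⟩ := hJlt y hy
        -- Each colour class is coinitial in `J`, so it has no least member below `y`.
        have hinf : {j : J | j.1 < y ∧ c j = q}.Infinite :=
          Set.infinite_of_forall_exists_lt fun a => by
            obtain ⟨j, hj, hjq⟩ := hcq q (min a j₀)
            exact ⟨j, ⟨lt_trans (hj.trans_le (min_le_right _ _)) hj₀, hjq⟩,
              hj.trans_le (min_le_left _ _)⟩
        refine (hinf.image (f := (Sum.inl : J → J ⊕ D × ℕ)) Sum.inl_injective.injOn).mono ?_
        rintro _ ⟨j, ⟨hj, rfl⟩, rfl⟩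
        exact ⟨hj, rfl⟩
      · exact hrow _ y d hd hdy
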